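/- **Definitions.** Let $S$ be a (discrete) semigroup. A weight on $S$ is a function $\omega : S \to (0,\infty)$ with $\omega(st) \le \omega(s)\omega(t)$ for all $s,t \in S$. The Beurling algebra $\ell^1(S,\omega)$ is the complex Banach algebra of all functions $f : S \to \mathbb{C}$ with $\|f\|_\omega = \sum_{s\in S} |f(s)|\,\omega(s) < \infty$, with the convolution product $(f*g)(x) = \sum_{st = x} f(s)g(t)$; and $\ell^1(S) = \ell^1(S,1)$. A Banach algebra $A$ is amenable if for every Banach $A$-bimodule $E$, every continuous derivation $D : A \to E^*$ (that is, a continuous linear map with $D(ab) = D(a)\cdot b + a\cdot D(b)$) into the dual bimodule $E^*$ is inner, i.e. there is $\varphi \in E^*$ with $D(a) = a\cdot\varphi - \varphi\cdot a$ for all $a \in A$. A band semigroup is a semigroup in which $s^2 = s$ for every $s$; a semilattice is a commutative band semigroup. With $S^1$ the unitization of $S$, the equivalence relation $\tau$ on $S$ is given by $s \,\tau\, t \iff S^1 s S^1 = S^1 t S^1$. **Theorem.** Let $S$ be a band semigroup and let $\omega$ be a weight on $S$. Then the following are equivalent: (i) $\ell^1(S,\omega)$ is amenable; (ii) $S$ is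 finite and each $\tau$-class is a singleton; (iii) $\ell^1(S)$ is amenable; (iv) $S$ is a finite semilattice. -/

import Mathlib

/-! ### Amenable Banach algebras -/

namespace BanachAmenability

universe u

/-- A Banach bimodule structure on a complex normed space `E` over a complex normed algebra `A`:
jointly bounded bilinear left and right actions (`left a x` is `a · x` and `right a x` is `x · a`)
satisfying the bimodule laws. -/
structure Bimodule (A E : Type*) [NonUnitalNormedRing A] [NormedSpace ℂ A]
    [NormedAddCommGroup E] [NormedSpace ℂ E] where
  left : A →L[ℂ] E →L[ℂ] E
  right : A →L[ℂ] E →L[ℂ] E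
  left_mul : ∀ (a b : A) (x : E), left (a * b) x = left a (left b x)
  right_mul : ∀ (a b : A) (x : E), right (a * b) x = right b (right a x)
  left_right : ∀ (a b : A) (x : E), left a (right b x) = right b (left a x)

section

variable {A E : Type*} [NonUnitalNormedRing A] [NormedSpace ℂ A]
  [NormedAddCommGroup E] [NormedSpace ℂ E]

/-- The dual bimodule structure on `E* = E →L[ℂ] ℂ`:
`(a · φ)(x) = φ(x · a)` and `(φ · a)(x) = φ(a · x)`. -/
noncomputable def Bimodule.dual (M : Bimodule A E) : Bimodule A (E →L[ℂ] ℂ) where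
  left := ((ContinuousLinearMap.compL ℂ E E ℂ).flip).comp M.right
  right := ((ContinuousLinearMap.compL ℂ E E ℂ).flip).comp M.left
  left_mul a b φ := by
    ext x
    simp [M.right_mul]
  right_mul a b φ := by
    ext x
    simp [M.left_mul]
  left_right a b φ := by
    ext x
    simp [M.left_right]

theorem Bimodule.dual_left_apply (M : Bimodule A E) (a : A) (φ : E →L[ℂ] ℂ) (x : E) :
    M.dual.left a φ x = φ (M.right a x) := rfl

theorem Bimodule.dual_right_apply (M : Bimodule A E) (a : A) (φ : E →L[ℂ] ℂ) (x : E) :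
    M.dual.right a φ x = φ (M.left a x) := rfl

/-- `D(ab) = D(a) · b + a · D(b)` for all `a, b`. -/
def Bimodule.IsDerivation (M : Bimodule A E) (D : A →L[ℂ] E) : Prop :=
  ∀ a b : A, D (a * b) = M.right b (D a) + M.left a (D b)

/-- `D(a) = a · x - x · a` for some `x` in the module. -/
def Bimodule.IsInner (M : Bimodule A E) (D : A →L[ℂ] E) : Prop :=
  ∃ x : E, ∀ a : A, D a = M.left a x - M.right a x

end

/-- A (complex) Banach algebra `A` is amenable if for every Banach `A`-bimodule `E`, every
continuous derivation from `A` into the dual bimodule `E*` is inner. Letting `E` range over the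
universe of `A` loses nothing: the test modules that produce a virtual diagonal are built from `A`
by projective tensor products, duals and closed submodules, and a virtual diagonal makes
derivations into every dual Banach bimodule inner, in any universe. -/
def IsAmenable (A : Type u) [NonUnitalNormedRing A] [NormedSpace ℂ A]
    [IsScalarTower ℂ A A] [SMulCommClass ℂ A A] [CompleteSpace A] : Prop :=
  ∀ (E : Type u) [NormedAddCommGroup E] [NormedSpace ℂ E] [CompleteSpace E]
    (M : Bimodule A E) (D : A →L[ℂ] (E →L[ℂ] ℂ)),
    M.dual.IsDerivation D → M.dual.IsInner D

end BanachAmenability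

/-! ### Weights and Beurling algebras on (discrete) semigroups -/

/-- A weight on a discrete semigroup: a positive submultiplicative function. -/
structure SemigroupWeight (S : Type*) [Semigroup S] where
  toFun : S → ℝ
  pos : ∀ s, 0 < toFun s
  mul_le : ∀ s t, toFun (s * t) ≤ toFun s * toFun t

namespace SemigroupWeight

instance {S : Type*} [Semigroup S] : CoeFun (SemigroupWeight S) (fun _ => S → ℝ) := ⟨toFun⟩

/-- The constant weight `1`. -/
def trivial (S : Type*) [Semigroup S] : SemigroupWeight S where
  toFun _ := 1
  pos _ := one_pos
  mul_le _ _ := by norm_num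

end SemigroupWeight

section

variable {S : Type*} [Semigroup S]

/-- The space of all `f : S → ℂ` with `∑ |f s| ω(s) < ∞`. -/
def beurlingSubmodule (ω : SemigroupWeight S) : Submodule ℂ (S → ℂ) where
  carrier := {f | Summable fun s => ‖f s‖ * ω s}
  zero_mem' := by simp
  add_mem' {f g} hf hg := by
    refine Summable.of_nonneg_of_le (fun s => by have := ω.pos s; positivity) (fun s => ?_)
      (Summable.add hf hg)
    rw [← add_mul]
    exact mul_le_mul_of_nonneg_right (norm_add_le _ _) (ω.pos s).le
  smul_mem' c f hf := by
    have := Summable.mul_left ‖c‖ hf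
    refine this.congr fun s => ?_
    simp [mul_assoc]

/-- The Beurling algebra `ℓ¹(S, ω)`. -/
def BeurlingAlgebra (ω : SemigroupWeight S) : Type _ := beurlingSubmodule ω

namespace BeurlingAlgebra

variable {ω : SemigroupWeight S}

noncomputable instance : AddCommGroup (BeurlingAlgebra ω) :=
  inferInstanceAs (AddCommGroup (beurlingSubmodule ω))

noncomputable instance : Module ℂ (BeurlingAlgebra ω) :=
  inferInstanceAs (Module ℂ (beurlingSubmodule ω))

instance : FunLike (BeurlingAlgebra ω) S ℂ where
  coe f := f.1
  coe_injective _ _ h := Subtype.ext h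

/-- The element of `ℓ¹(S, ω)` given by a weighted summable function. -/
def mk (f : S → ℂ) (hf : Summable fun s => ‖f s‖ * ω s) : BeurlingAlgebra ω := ⟨f, hf⟩

theorem mk_apply (f : S → ℂ) (hf : Summable fun s => ‖f s‖ * ω s) (s : S) :
    (mk f hf : BeurlingAlgebra ω) s = f s := rfl

theorem summable (f : BeurlingAlgebra ω) : Summable fun s => ‖f s‖ * ω s := f.2

theorem ext {f g : BeurlingAlgebra ω} (h : ∀ s, f s = g s) : f = g := DFunLike.ext f g h

theorem add_apply (f g : BeurlingAlgebra ω) (s : S) : (f + g) s = f s + g s := rfl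

theorem smul_apply (c : ℂ) (f : BeurlingAlgebra ω) (s : S) : (c • f) s = c * f s := rfl

theorem zero_apply (s : S) : (0 : BeurlingAlgebra ω) s = 0 := rfl

theorem sub_apply (f g : BeurlingAlgebra ω) (s : S) : (f - g) s = f s - g s := rfl

/-- The norm `‖f‖ = ∑ |f s| ω(s)`. -/
noncomputable instance : Norm (BeurlingAlgebra ω) := ⟨fun f => ∑' s, ‖f s‖ * ω s⟩

theorem norm_def (f : BeurlingAlgebra ω) : ‖f‖ = ∑' s, ‖f s‖ * ω s := rfl

theorem term_nonneg (f : BeurlingAlgebra ω) (s : S) : 0 ≤ ‖f s‖ * ω s :=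
  mul_nonneg (norm_nonneg _) (ω.pos s).le

theorem normedSpaceCore : NormedSpace.Core ℂ (BeurlingAlgebra ω) where
  norm_nonneg f := tsum_nonneg f.term_nonneg
  norm_smul c f := by
    simp only [norm_def, smul_apply, norm_mul, mul_assoc]
    exact tsum_mul_left
  norm_triangle f g := by
    simp only [norm_def]
    rw [← f.summable.tsum_add g.summable]
    refine (f + g).summable.tsum_le_tsum (fun s => ?_) (f.summable.add g.summable)
    rw [← add_mul]
    exact mul_le_mul_of_nonneg_right (norm_add_le _ _) (ω.pos s).le
  norm_eq_zero_iff f := by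
    constructor
    · intro h
      have h1 : HasSum (fun s => ‖f s‖ * ω s) 0 := h ▸ f.summable.hasSum
      rw [hasSum_zero_iff_of_nonneg f.term_nonneg] at h1
      refine BeurlingAlgebra.ext fun s => ?_
      have h2 : ‖f s‖ * ω s = 0 := congrFun h1 s
      simpa [(ω.pos s).ne', zero_apply] using h2
    · rintro rfl
      simp [norm_def, zero_apply]

noncomputable instance : NormedAddCommGroup (BeurlingAlgebra ω) :=
  NormedAddCommGroup.ofCore normedSpaceCore

noncomputable instance : NormedSpace ℂ (BeurlingAlgebra ω) :=
  NormedSpace.ofCore normedSpaceCore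

/-- Multiplication by the weight identifies `ℓ¹(S, ω)` isometrically with `ℓ¹(S)`. -/
noncomputable def isometryEquivLp : BeurlingAlgebra ω ≃ᵢ lp (fun _ : S => ℂ) 1 where
  toFun f := ⟨fun s => f s * (ω s : ℂ), memℓp_gen (by
    refine f.summable.congr fun s => ?_
    simp [abs_of_pos (ω.pos s)])⟩
  invFun g := mk (fun s => g s * ((ω s)⁻¹ : ℝ)) (by
    have h := (memℓp_gen_iff (by norm_num)).1 (lp.memℓp g)
    refine h.congr fun s => ?_
    have := (ω.pos s).ne'
    simp [abs_of_pos (ω.pos s), this])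
  left_inv f := BeurlingAlgebra.ext fun s => by
    have : (ω s : ℂ) ≠ 0 := by exact_mod_cast (ω.pos s).ne'
    simp [mk_apply, this]
  right_inv g := by
    ext s
    have : (ω s : ℂ) ≠ 0 := by exact_mod_cast (ω.pos s).ne'
    simp [mk_apply, this]
  isometry_toFun := by
    refine Isometry.of_dist_eq fun f g => ?_
    rw [dist_eq_norm, dist_eq_norm, lp.norm_eq_tsum_rpow (by norm_num), norm_def]
    simp only [ENNReal.toReal_one, Real.rpow_one, div_one]
    refine tsum_congr fun s => ?_
    change ‖f s * (ω s : ℂ) - g s * (ω s : ℂ)‖ = ‖f s - g s‖ * ω s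
    rw [← sub_mul, norm_mul, Complex.norm_of_nonneg (ω.pos s).le]

instance : CompleteSpace (BeurlingAlgebra ω) := isometryEquivLp.completeSpace

theorem summable_mul_term (f g : BeurlingAlgebra ω) :
    Summable fun p : S × S => (‖f p.1‖ * ω p.1) * (‖g p.2‖ * ω p.2) :=
  f.summable.mul_of_nonneg g.summable f.term_nonneg g.term_nonneg

theorem summable_weighted_pairs (f g : BeurlingAlgebra ω) :
    Summable fun p : S × S => ‖f p.1 * g p.2‖ * ω (p.1 * p.2) := by
  refine Summable.of_nonneg_of_le
    (fun p => mul_nonneg (norm_nonneg _) (ω.pos _).le) (fun p => ?_) (summable_mul_term f g)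
  calc ‖f p.1 * g p.2‖ * ω (p.1 * p.2) ≤ ‖f p.1 * g p.2‖ * (ω p.1 * ω p.2) :=
        mul_le_mul_of_nonneg_left (ω.mul_le _ _) (norm_nonneg _)
    _ = _ := by rw [norm_mul]; ring

/-- The pairs `(s, t)` with `s t = x`. -/
abbrev Fiber (x : S) : Type _ := {p : S × S // p.1 * p.2 = x}

theorem summable_norm_fiber (f g : BeurlingAlgebra ω) (x : S) :
    Summable fun p : Fiber x => ‖f p.1.1 * g p.1.2‖ := by
  have h := (summable_weighted_pairs f g).comp_injective
    (i := fun p : Fiber x => p.1) Subtype.val_injective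
  have h2 := h.mul_right (ω x)⁻¹
  refine h2.congr fun p => ?_
  have := (ω.pos x).ne'
  simp [Function.comp, p.2, this]

/-- The values of the convolution product: `(f * g)(x) = ∑_{st = x} f(s) g(t)`. -/
noncomputable def conv (f g : BeurlingAlgebra ω) (x : S) : ℂ :=
  ∑' p : Fiber x, f p.1.1 * g p.1.2

theorem summable_sigma (f g : BeurlingAlgebra ω) :
    Summable fun q : (Σ x : S, Fiber x) => ‖f q.2.1.1 * g q.2.1.2‖ * ω q.1 := by
  have h := (Equiv.sigmaFiberEquiv (fun p : S × S => p.1 * p.2)).summable_iff.2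
    (summable_weighted_pairs f g)
  refine h.congr fun q => ?_
  obtain ⟨x, ⟨p, rfl⟩⟩ := q
  rfl

theorem norm_conv_le (f g : BeurlingAlgebra ω) (x : S) :
    ‖conv f g x‖ * ω x ≤ ∑' p : Fiber x, ‖f p.1.1 * g p.1.2‖ * ω x := by
  rw [tsum_mul_right]
  exact mul_le_mul_of_nonneg_right (norm_tsum_le_tsum_norm (summable_norm_fiber f g x)) (ω.pos x).le

theorem summable_conv (f g : BeurlingAlgebra ω) : Summable fun x => ‖conv f g x‖ * ω x :=
  Summable.of_nonneg_of_le (fun x => mul_nonneg (norm_nonneg _) (ω.pos x).le)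
    (norm_conv_le f g) (summable_sigma f g).sigma

noncomputable instance : Mul (BeurlingAlgebra ω) := ⟨fun f g => mk (conv f g) (summable_conv f g)⟩

theorem mul_apply (f g : BeurlingAlgebra ω) (x : S) :
    (f * g) x = ∑' p : Fiber x, f p.1.1 * g p.1.2 := rfl

theorem norm_mul_le' (f g : BeurlingAlgebra ω) : ‖f * g‖ ≤ ‖f‖ * ‖g‖ := by
  have h1 : ‖f * g‖ ≤ ∑' x, ∑' p : Fiber x, ‖f p.1.1 * g p.1.2‖ * ω x :=
    (summable_conv f g).tsum_le_tsum (norm_conv_le f g) (summable_sigma f g).sigma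
  rw [← (summable_sigma f g).tsum_sigma] at h1
  refine h1.trans ?_
  have h2 : ∑' q : (Σ x : S, Fiber x), ‖f q.2.1.1 * g q.2.1.2‖ * ω q.1
      = ∑' p : S × S, ‖f p.1 * g p.2‖ * ω (p.1 * p.2) := by
    rw [← (Equiv.sigmaFiberEquiv (fun p : S × S => p.1 * p.2)).tsum_eq]
    refine tsum_congr fun q => ?_
    obtain ⟨x, ⟨p, rfl⟩⟩ := q
    rfl
  rw [h2, norm_def, norm_def, f.summable.tsum_mul_tsum g.summable (summable_mul_term f g)]
  refine (summable_weighted_pairs f g).tsum_le_tsum (fun p => ?_) (summable_mul_term f g)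
  calc ‖f p.1 * g p.2‖ * ω (p.1 * p.2) ≤ ‖f p.1 * g p.2‖ * (ω p.1 * ω p.2) :=
        mul_le_mul_of_nonneg_left (ω.mul_le _ _) (norm_nonneg _)
    _ = _ := by rw [norm_mul]; ring

theorem summable_triple (f g h : BeurlingAlgebra ω) (x : S) :
    Summable fun q : {q : S × S × S // q.1 * (q.2.1 * q.2.2) = x} =>
      f q.1.1 * (g q.1.2.1 * h q.1.2.2) := by
  have h1 : Summable fun q : S × S × S =>
      (‖f q.1‖ * ω q.1) * ((‖g q.2.1‖ * ω q.2.1) * (‖h q.2.2‖ * ω q.2.2)) :=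
    f.summable.mul_of_nonneg (summable_mul_term g h) f.term_nonneg
      (fun p => mul_nonneg (g.term_nonneg _) (h.term_nonneg _))
  have h2 := (h1.comp_injective
    (i := fun q : {q : S × S × S // q.1 * (q.2.1 * q.2.2) = x} => q.1)
    Subtype.val_injective).mul_right (ω x)⁻¹
  refine Summable.of_norm (Summable.of_nonneg_of_le (fun _ => norm_nonneg _) (fun q => ?_) h2)
  rw [le_mul_inv_iff₀ (ω.pos x)]
  obtain ⟨⟨r, s, t⟩, rfl⟩ := q
  simp only [Function.comp, norm_mul]
  have h3 : ω (r * (s * t)) ≤ ω r * (ω s * ω t) :=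
    (ω.mul_le _ _).trans (mul_le_mul_of_nonneg_left (ω.mul_le _ _) (ω.pos r).le)
  calc ‖f r‖ * (‖g s‖ * ‖h t‖) * ω (r * (s * t))
      ≤ ‖f r‖ * (‖g s‖ * ‖h t‖) * (ω r * (ω s * ω t)) :=
        mul_le_mul_of_nonneg_left h3 (by positivity)
    _ = _ := by ring

/-- Triples with product `x`, bracketed to the right. -/
def tripleEquivRight (x : S) : (Σ p : Fiber x, Fiber p.1.2) ≃
    {q : S × S × S // q.1 * (q.2.1 * q.2.2) = x} where
  toFun a := ⟨(a.1.1.1, a.2.1.1, a.2.1.2), by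
    obtain ⟨⟨⟨r, u⟩, hp⟩, ⟨⟨s, t⟩, hq⟩⟩ := a
    simp only at hp hq ⊢
    rw [hq, hp]⟩
  invFun q := ⟨⟨(q.1.1, q.1.2.1 * q.1.2.2), q.2⟩, ⟨(q.1.2.1, q.1.2.2), rfl⟩⟩
  left_inv a := by
    obtain ⟨⟨⟨r, u⟩, hp⟩, ⟨⟨s, t⟩, hq⟩⟩ := a
    simp only at hp hq
    subst hq
    rfl
  right_inv q := rfl

/-- Triples with product `x`, bracketed to the left. -/
def tripleEquivLeft (x : S) : (Σ p : Fiber x, Fiber p.1.1) ≃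
    {q : S × S × S // q.1 * (q.2.1 * q.2.2) = x} where
  toFun a := ⟨(a.2.1.1, a.2.1.2, a.1.1.2), by
    obtain ⟨⟨⟨u, t⟩, hp⟩, ⟨⟨r, s⟩, hq⟩⟩ := a
    simp only at hp hq ⊢
    rw [← mul_assoc, hq, hp]⟩
  invFun q := ⟨⟨(q.1.1 * q.1.2.1, q.1.2.2), by rw [mul_assoc]; exact q.2⟩,
    ⟨(q.1.1, q.1.2.1), rfl⟩⟩
  left_inv a := by
    obtain ⟨⟨⟨u, t⟩, hp⟩, ⟨⟨r, s⟩, hq⟩⟩ := a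
    simp only at hp hq
    subst hq
    rfl
  right_inv q := rfl

theorem mul_assoc' (f g h : BeurlingAlgebra ω) : f * g * h = f * (g * h) := by
  refine BeurlingAlgebra.ext fun x => ?_
  have hs := summable_triple f g h x
  have hL : (f * g * h) x = ∑' q : {q : S × S × S // q.1 * (q.2.1 * q.2.2) = x},
      f q.1.1 * (g q.1.2.1 * h q.1.2.2) := by
    rw [← (tripleEquivLeft x).tsum_eq]
    refine Eq.trans ?_ (Summable.tsum_sigma ((tripleEquivLeft x).summable_iff.2 hs)).symm
    rw [mul_apply]
    refine tsum_congr fun p => ?_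
    rw [mul_apply, ← tsum_mul_right]
    exact tsum_congr fun q => mul_assoc _ _ _
  have hR : (f * (g * h)) x = ∑' q : {q : S × S × S // q.1 * (q.2.1 * q.2.2) = x},
      f q.1.1 * (g q.1.2.1 * h q.1.2.2) := by
    rw [← (tripleEquivRight x).tsum_eq]
    refine Eq.trans ?_ (Summable.tsum_sigma ((tripleEquivRight x).summable_iff.2 hs)).symm
    rw [mul_apply]
    refine tsum_congr fun p => ?_
    rw [mul_apply, ← tsum_mul_left]
    rfl
  rw [hL, hR]

noncomputable instance : NonUnitalNormedRing (BeurlingAlgebra ω) where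
  __ := (inferInstance : NormedAddCommGroup (BeurlingAlgebra ω))
  left_distrib f g h := BeurlingAlgebra.ext fun x => by
    simp only [mul_apply, add_apply, mul_add]
    exact (summable_norm_fiber f g x).of_norm.tsum_add (summable_norm_fiber f h x).of_norm
  right_distrib f g h := BeurlingAlgebra.ext fun x => by
    simp only [mul_apply, add_apply, add_mul]
    exact (summable_norm_fiber f h x).of_norm.tsum_add (summable_norm_fiber g h x).of_norm
  zero_mul f := BeurlingAlgebra.ext fun x => by
    simp [mul_apply, zero_apply]
  mul_zero f := BeurlingAlgebra.ext fun x => by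
    simp [mul_apply, zero_apply]
  mul_assoc := mul_assoc'
  norm_mul_le := norm_mul_le'

instance : IsScalarTower ℂ (BeurlingAlgebra ω) (BeurlingAlgebra ω) where
  smul_assoc c f g := BeurlingAlgebra.ext fun x => by
    simp only [smul_eq_mul, smul_apply, mul_apply, mul_assoc]
    exact tsum_mul_left

instance : SMulCommClass ℂ (BeurlingAlgebra ω) (BeurlingAlgebra ω) where
  smul_comm c f g := BeurlingAlgebra.ext fun x => by
    simp only [smul_eq_mul, smul_apply, mul_apply, mul_left_comm _ c]
    exact tsum_mul_left.symm

end BeurlingAlgebra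

end

/-! ### Bands, semilattices and the relation `τ` -/

/-- A band semigroup: every element is idempotent. -/
def IsBandSemigroup (S : Type*) [Semigroup S] : Prop := ∀ s : S, IsIdempotentElem s

/-- A semilattice: a commutative band semigroup. -/
def IsSemilatticeSemigroup (S : Type*) [Semigroup S] : Prop :=
  IsBandSemigroup S ∧ ∀ s t : S, s * t = t * s

/-- The principal two-sided ideal `S¹ s S¹`, as a subset of the unitization `S¹ = WithOne S`. -/
def principalIdeal {S : Type*} [Semigroup S] (s : S) : Set (WithOne S) :=
  {x | ∃ a b : WithOne S, x = a * (s : WithOne S) * b}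

/-- The equivalence relation `τ`: `s τ t` iff `S¹ s S¹ = S¹ t S¹`. -/
def tauSetoid (S : Type*) [Semigroup S] : Setoid S := Setoid.ker principalIdeal

/-! Everything is tied to (iv). The weight hardly matters: on a band `ω s ≤ ω s ^ 2` forces `1 ≤ ω
s`, so bounded families indexed by `S` extend to `ℓ¹(S, ω)`, and both amenability statements are
treated at once.

If `S` is a finite semilattice, the point masses are finitely many commuting idempotents spanning
the algebra, and a derivation can be made inner on them one idempotent at a time
(`exists_inner_on_idempotents`).

Conversely, amenability is applied to one explicit derivation, obtained by dimension shifting on the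
bounded functions on `S¹ × S¹`. It yields a functional `m` that behaves as a virtual diagonal of
`S¹` (`exists_isVirtualDiagonal`). Read as a finitely additive measure, `m` takes contradictory
values on one set if `S¹` contains two distinct elements forming a right zero band
(`eq_of_right_zero`). By symmetry the same holds for left zero bands, and since `s * t` and `t * s`
generate the same ideal in a band, `S¹` is commutative (`mul_comm_of_band`). In a semilattice `m` is
orthonormal on pairs of characters. An indicator that is an integer combination of characters then
has a square of measure `∑ c_χ²`, a positive integer, so packing disjoint squares bounds the number
of elements by `‖m‖` (`card_le_norm`).

The link with `τ` is elementary: `s * t` and `t * s` are always `τ`-related in a band, and `τ` is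
equality in a semilattice. -/

open BanachAmenability
open scoped ENNReal

/-! ### Derivations on finitely many commuting idempotents -/

namespace BanachAmenability

variable {A E : Type*} [NonUnitalNormedRing A] [NormedSpace ℂ A]
  [NormedAddCommGroup E] [NormedSpace ℂ E]

/-- Induction on `T`: after subtracting an inner derivation, `d` vanishes on the earlier
idempotents, and the new idempotent `e` is corrected by `e · d e - d e · e`. No duality of the
module is needed. -/
theorem Bimodule.IsDerivation.exists_inner_on_idempotents {M : Bimodule A E} {D : A →L[ℂ] E}
    (hD : M.IsDerivation D) (T : Finset A) (hT : ∀ e ∈ T, IsIdempotentElem e)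
    (hc : ∀ e ∈ T, ∀ f ∈ T, e * f = f * e) :
    ∃ x : E, ∀ e ∈ T, D e = M.left e x - M.right e x := by
  classical
  induction T using Finset.induction_on with
  | empty => exact ⟨0, by simp⟩
  | insert e T _ ih =>
    obtain ⟨x, hx⟩ := ih (fun f hf => hT f (Finset.mem_insert_of_mem hf))
      (fun f hf g hg => hc f (Finset.mem_insert_of_mem hf) g (Finset.mem_insert_of_mem hg))
    have hee : e * e = e := hT e (Finset.mem_insert_self _ _)
    let d : A → E := fun a => D a - (M.left a x - M.right a x)
    have hd : ∀ a b, d (a * b) = M.right b (d a) + M.left a (d b) := by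
      intro a b
      simp only [d, hD a b, M.left_mul, M.right_mul, map_sub, M.left_right]
      abel
    have hd0 : ∀ f ∈ T, d f = 0 := fun f hf => by simp [d, hx f hf]
    have hde : d e = M.right e (d e) + M.left e (d e) := by rw [← hd, hee]
    have hl : ∀ z, M.left e (M.left e z) = M.left e z := fun z => by rw [← M.left_mul, hee]
    have hr : ∀ z, M.right e (M.right e z) = M.right e z := fun z => by rw [← M.right_mul, hee]
    have hlr : M.left e (M.right e (d e)) = 0 := by
      have h := congrArg (M.left e) hde
      rw [map_add, hl] at h
      simpa using h
    -- Since `e · d e · e = 0`, the commutator of `e` with the added term is `d e · e + e · d e = d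
    -- e`. For `f ∈ T`, expanding `d (f * e) = d (e * f)` gives `f · d e = d e · f`, so the added
    -- term commutes with `f`.
    refine ⟨x + (M.left e (d e) - M.right e (d e)), fun f hf => ?_⟩
    have hDd : D f = d f + (M.left f x - M.right f x) := by simp [d]
    clear_value d
    have key : d f = M.left f (M.left e (d e) - M.right e (d e))
        - M.right f (M.left e (d e) - M.right e (d e)) := by
      rcases Finset.mem_insert.1 hf with rfl | hfT
      · simp only [map_sub, hl, hr, ← M.left_right, hlr]
        rw [sub_zero, zero_sub, sub_neg_eq_add, add_comm]
        exact hde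
      · have hcom : e * f = f * e := hc e (Finset.mem_insert_self _ _) f hf
        have hswap : M.left f (d e) = M.right f (d e) := by
          have h1 := hd f e
          have h2 := hd e f
          rw [hd0 f hfT, map_zero, zero_add] at h1
          rw [hd0 f hfT, map_zero, add_zero, hcom] at h2
          rw [← h1, h2]
        have h1 : M.left f (M.left e (d e)) = M.right f (M.left e (d e)) := by
          rw [← M.left_mul, ← hcom, M.left_mul, hswap, M.left_right]
        have h2 : M.left f (M.right e (d e)) = M.right f (M.right e (d e)) := by
          rw [M.left_right, hswap, ← M.right_mul, ← M.right_mul, hcom]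
        rw [hd0 f hfT, map_sub, map_sub, h1, h2, sub_self]
    rw [hDd, key, map_add, map_add]
    abel

end BanachAmenability

theorem SemigroupWeight.one_le {S : Type*} [Semigroup S] (ω : SemigroupWeight S) {s : S}
    (hs : IsIdempotentElem s) : 1 ≤ ω s := by
  have h := ω.mul_le s s
  rw [hs.eq] at h
  exact le_of_mul_le_mul_right (by simpa using h) (ω.pos s)

/-! ### Point masses in the Beurling algebra, and finite semilattices -/

namespace BeurlingAlgebra

variable {S : Type*} [Semigroup S] {ω : SemigroupWeight S}

open Classical in
/-- The point mass at `s`. -/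
noncomputable def delta (ω : SemigroupWeight S) (s : S) : BeurlingAlgebra ω :=
  mk (Pi.single s 1) (summable_of_ne_finset_zero (s := {s}) fun t ht => by
    simp [Finset.notMem_singleton.1 ht])

open Classical in
theorem delta_apply (s t : S) : delta ω s t = if t = s then 1 else 0 := by
  simp [delta, mk_apply, Pi.single_apply]

theorem norm_delta (s : S) : ‖delta ω s‖ = ω s := by
  rw [norm_def, tsum_eq_single s fun t ht => by simp [delta_apply, ht]]
  simp [delta_apply]

theorem delta_mul_delta (s t : S) : delta ω s * delta ω t = delta ω (s * t) := by
  classical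
  refine BeurlingAlgebra.ext fun x => ?_
  rw [mul_apply, delta_apply]
  split_ifs with h
  · subst h
    rw [tsum_eq_single ⟨(s, t), rfl⟩]
    · simp [delta_apply]
    · rintro ⟨⟨a, b⟩, hp⟩ hne
      simp only [delta_apply]
      split_ifs <;> simp_all
  · convert tsum_zero with p
    obtain ⟨⟨a, b⟩, hp⟩ := p
    simp only [delta_apply]
    split_ifs with h1 h2 <;> simp_all

theorem norm_apply_mul_le (f : BeurlingAlgebra ω) (s : S) : ‖f s‖ * ω s ≤ ‖f‖ :=
  f.summable.le_tsum s fun t _ => f.term_nonneg t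

/-- Evaluation at a point, as a linear map. -/
def evalLinear (ω : SemigroupWeight S) (s : S) : BeurlingAlgebra ω →ₗ[ℂ] ℂ where
  toFun f := f s
  map_add' _ _ := rfl
  map_smul' _ _ := rfl

theorem hasSum_delta (f : BeurlingAlgebra ω) : HasSum (fun s => f s • delta ω s) f := by
  classical
  have hs : Summable fun s => f s • delta ω s :=
    Summable.of_norm (by simpa [norm_smul, norm_delta] using f.summable)
  have h : ∑' s, f s • delta ω s = f := by
    refine BeurlingAlgebra.ext fun t => ?_
    let ev : BeurlingAlgebra ω →L[ℂ] ℂ := (evalLinear ω t).mkContinuous (ω t)⁻¹ fun g => by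
      rw [inv_mul_eq_div, le_div_iff₀ (ω.pos t)]
      exact norm_apply_mul_le g t
    have := ev.map_tsum hs
    change ev (∑' s, f s • delta ω s) = _
    rw [this]
    change ∑' s, (f s • delta ω s) t = f t
    rw [tsum_eq_single t]
    · simp [smul_apply, delta_apply]
    · intro s hst
      simp [smul_apply, delta_apply, hst.symm]
  simpa only [h] using hs.hasSum

theorem clm_ext {B : Type*} [NormedAddCommGroup B] [NormedSpace ℂ B]
    {Φ Ψ : BeurlingAlgebra ω →L[ℂ] B} (h : ∀ s, Φ (delta ω s) = Ψ (delta ω s)) : Φ = Ψ := by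
  ext f
  have h1 := (hasSum_delta f).mapL Φ
  have h2 := (hasSum_delta f).mapL Ψ
  simp only [map_smul, h] at h1 h2
  exact h1.unique h2

/-- A family bounded by a multiple of the weight extends to a bounded linear map on `ℓ¹(S, ω)`. -/
noncomputable def lift {B : Type*} [NormedAddCommGroup B] [NormedSpace ℂ B] [CompleteSpace B]
    (T : S → B) (C : ℝ) (hT : ∀ s, ‖T s‖ ≤ C * ω s) : BeurlingAlgebra ω →L[ℂ] B :=
  have hle : ∀ (f : BeurlingAlgebra ω) s, ‖f s • T s‖ ≤ C * (‖f s‖ * ω s) := fun f s => by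
    rw [norm_smul, mul_left_comm]
    exact mul_le_mul_of_nonneg_left (hT s) (norm_nonneg _)
  have hs : ∀ f : BeurlingAlgebra ω, Summable fun s => f s • T s := fun f =>
    Summable.of_norm_bounded (f.summable.mul_left C) (hle f)
  LinearMap.mkContinuous
    { toFun := fun f => ∑' s, f s • T s
      map_add' := fun f g => by
        rw [← (hs f).tsum_add (hs g)]
        exact tsum_congr fun s => by rw [add_apply, add_smul]
      map_smul' := fun c f => by
        rw [RingHom.id_apply, ← (hs f).tsum_const_smul c]
        exact tsum_congr fun s => by rw [smul_apply, mul_smul] } C fun f => by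
    rw [norm_def, ← tsum_mul_left]
    exact tsum_of_norm_bounded (f.summable.mul_left C).hasSum (hle f)

theorem lift_delta {B : Type*} [NormedAddCommGroup B] [NormedSpace ℂ B] [CompleteSpace B]
    (T : S → B) (C : ℝ) (hT : ∀ s, ‖T s‖ ≤ C * ω s) (s : S) : lift T C hT (delta ω s) = T s := by
  change ∑' t, delta ω s t • T t = T s
  rw [tsum_eq_single s fun t ht => by simp [delta_apply, ht]]
  simp [delta_apply]

theorem isAmenable_of_finite_semilattice [Finite S] (hS : IsSemilatticeSemigroup S) :
    IsAmenable (BeurlingAlgebra ω) := by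
  classical
  intro E _ _ _ M D hD
  have := Fintype.ofFinite S
  obtain ⟨x, hx⟩ := hD.exists_inner_on_idempotents (Finset.univ.image (delta ω))
    (by simp only [Finset.mem_image, Finset.mem_univ, true_and]
        rintro _ ⟨s, rfl⟩
        rw [IsIdempotentElem, delta_mul_delta, (hS.1 s).eq])
    (by simp only [Finset.mem_image, Finset.mem_univ, true_and]
        rintro _ ⟨s, rfl⟩ _ ⟨t, rfl⟩
        rw [delta_mul_delta, delta_mul_delta, hS.2])
  have h : D = M.dual.left.flip x - M.dual.right.flip x :=
    clm_ext fun s => hx _ (Finset.mem_image_of_mem _ (Finset.mem_univ s))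
  exact ⟨x, fun a => by rw [h]; rfl⟩

end BeurlingAlgebra

/-! ### Translations on bounded functions -/

/-- Precomposition with `φ`, on bounded functions. -/
noncomputable def boundedComp {X Y : Type*} (φ : X → Y) :
    lp (fun _ : Y => ℂ) ∞ →L[ℂ] lp (fun _ : X => ℂ) ∞ :=
  LinearMap.mkContinuous
    { toFun := fun F => ⟨fun x => F (φ x), memℓp_infty ⟨‖F‖, by
        rintro _ ⟨x, rfl⟩
        exact lp.norm_apply_le_norm ENNReal.top_ne_zero F (φ x)⟩⟩
      map_add' := fun _ _ => rfl
      map_smul' := fun _ _ => rfl } 1 fun F => by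
    rw [one_mul]
    exact lp.norm_le_of_forall_le (norm_nonneg F) fun x =>
      lp.norm_apply_le_norm ENNReal.top_ne_zero F (φ x)

theorem boundedComp_apply {X Y : Type*} (φ : X → Y) (F : lp (fun _ : Y => ℂ) ∞) (x : X) :
    boundedComp φ F x = F (φ x) := rfl

theorem norm_boundedComp_le {X Y : Type*} (φ : X → Y) : ‖boundedComp φ‖ ≤ 1 :=
  LinearMap.mkContinuous_norm_le _ zero_le_one _

/-! ### Invariant functionals -/

/-- A functional on the bounded functions on `M × M` that plays the role of a virtual diagonal:
it balances translations in the two variables and multiplies out to the evaluation at `1`. -/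
structure IsVirtualDiagonal {M : Type*} [Monoid M] (m : lp (fun _ : M × M => ℂ) ∞ →L[ℂ] ℂ) :
    Prop where
  balanced : ∀ (u : M) (F : lp (fun _ : M × M => ℂ) ∞),
    m (boundedComp (fun p => (u * p.1, p.2)) F) = m (boundedComp (fun p => (p.1, p.2 * u)) F)
  unital : ∀ f : lp (fun _ : M => ℂ) ∞, m (boundedComp (fun p => p.1 * p.2) f) = f 1

/-! ### From amenability to a virtual diagonal -/

namespace BeurlingAlgebra

variable {S : Type*} [Semigroup S] {ω : SemigroupWeight S}

section

variable {B : Type*} [NormedAddCommGroup B] [NormedSpace ℂ B]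

theorem bilinear_clm_ext (Φ Ψ : BeurlingAlgebra ω →L[ℂ] BeurlingAlgebra ω →L[ℂ] B)
    (h : ∀ s t, Φ (delta ω s) (delta ω t) = Ψ (delta ω s) (delta ω t)) (a b) : Φ a b = Ψ a b := by
  rw [clm_ext (Φ := Φ) (Ψ := Ψ) fun s => clm_ext fun t => h s t]

theorem isDerivation_of_delta {M : Bimodule (BeurlingAlgebra ω) B} {D : BeurlingAlgebra ω →L[ℂ] B}
    (h : ∀ s t, D (delta ω s * delta ω t)
      = M.right (delta ω t) (D (delta ω s)) + M.left (delta ω s) (D (delta ω t))) :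
    M.IsDerivation D := fun a b =>
  bilinear_clm_ext ((ContinuousLinearMap.compL ℂ _ _ _ D).comp (ContinuousLinearMap.mul ℂ _))
    (M.right.flip.comp D + ((ContinuousLinearMap.compL ℂ _ _ _).flip D).comp M.left) h a b

variable [CompleteSpace B]

/-- Commuting actions of `S` by translations of moderate norm extend to `ℓ¹(S, ω)`. -/
noncomputable def liftBimodule (l r : S → B →L[ℂ] B) (C C' : ℝ) (hl : ∀ s, ‖l s‖ ≤ C * ω s)
    (hr : ∀ s, ‖r s‖ ≤ C' * ω s) (hll : ∀ s t x, l (s * t) x = l s (l t x))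
    (hrr : ∀ s t x, r (s * t) x = r t (r s x)) (hlr : ∀ s t x, l s (r t x) = r t (l s x)) :
    Bimodule (BeurlingAlgebra ω) B where
  left := lift l C hl
  right := lift r C' hr
  left_mul a b x := bilinear_clm_ext
    ((ContinuousLinearMap.compL ℂ _ _ _ ((lift l C hl).flip x)).comp (ContinuousLinearMap.mul ℂ _))
    (((ContinuousLinearMap.compL ℂ (BeurlingAlgebra ω) B B).flip ((lift l C hl).flip x)).comp (lift l C hl))
    (fun s t => by simp [delta_mul_delta, lift_delta, hll]) a b
  right_mul a b x := bilinear_clm_ext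
    ((ContinuousLinearMap.compL ℂ _ _ _ ((lift r C' hr).flip x)).comp (ContinuousLinearMap.mul ℂ _))
    ((lift r C' hr).flip.comp ((lift r C' hr).flip x))
    (fun s t => by simp [delta_mul_delta, lift_delta, hrr]) a b
  left_right a b x := bilinear_clm_ext
    (((ContinuousLinearMap.compL ℂ (BeurlingAlgebra ω) B B).flip ((lift r C' hr).flip x)).comp (lift l C hl))
    ((lift r C' hr).flip.comp ((lift l C hl).flip x))
    (fun s t => by simp [lift_delta, hlr]) a b

variable (l r : S → B →L[ℂ] B) (C C' : ℝ) (hl : ∀ s, ‖l s‖ ≤ C * ω s)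
  (hr : ∀ s, ‖r s‖ ≤ C' * ω s) (hll : ∀ s t x, l (s * t) x = l s (l t x))
  (hrr : ∀ s t x, r (s * t) x = r t (r s x)) (hlr : ∀ s t x, l s (r t x) = r t (l s x))

theorem liftBimodule_left_delta (s : S) :
    (liftBimodule l r C C' hl hr hll hrr hlr).left (delta ω s) = l s := lift_delta l C hl s

theorem liftBimodule_right_delta (s : S) :
    (liftBimodule l r C C' hl hr hll hrr hlr).right (delta ω s) = r s := lift_delta r C' hr s

end

/-- Right translation on bounded functions on `S¹ × S¹`, twisted by a coboundary. -/
noncomputable def twistedRight (u : S) :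
    lp (fun _ : WithOne S × WithOne S => ℂ) ∞ →L[ℂ] lp (fun _ : WithOne S × WithOne S => ℂ) ∞ :=
  boundedComp (fun p => ((u : WithOne S) * p.1, p.2))
    - boundedComp (fun p => ((u : WithOne S), p.1 * p.2))

/-- Right multiplication in the second variable, the left action on bounded functions. -/
noncomputable def leftTranslation (u : S) :
    lp (fun _ : WithOne S × WithOne S => ℂ) ∞ →L[ℂ] lp (fun _ : WithOne S × WithOne S => ℂ) ∞ :=
  boundedComp (fun p => (p.1, p.2 * (u : WithOne S)))

theorem twistedRight_apply (u : S) (F : lp (fun _ : WithOne S × WithOne S => ℂ) ∞)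
    (p : WithOne S × WithOne S) : twistedRight u F p = F (u * p.1, p.2) - F (u, p.1 * p.2) := rfl

theorem leftTranslation_apply (u : S) (F : lp (fun _ : WithOne S × WithOne S => ℂ) ∞)
    (p : WithOne S × WithOne S) : leftTranslation u F p = F (p.1, p.2 * u) := rfl

theorem norm_twistedRight_le (hω : ∀ s, 1 ≤ ω s) (u : S) : ‖twistedRight u‖ ≤ 2 * ω u := by
  refine (norm_sub_le _ _).trans ?_
  have h1 := norm_boundedComp_le (fun p : WithOne S × WithOne S => ((u : WithOne S) * p.1, p.2))
  have h2 := norm_boundedComp_le (fun p : WithOne S × WithOne S => ((u : WithOne S), p.1 * p.2))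
  linarith [hω u]

theorem norm_leftTranslation_le (hω : ∀ s, 1 ≤ ω s) (u : S) :
    ‖leftTranslation u‖ ≤ 1 * ω u := by
  rw [one_mul]
  exact (norm_boundedComp_le _).trans (hω u)

/-- The dimension-shifting bimodule: its dual carries a derivation whose being inner amounts to a
virtual diagonal. -/
noncomputable def shiftBimodule (hω : ∀ s, 1 ≤ ω s) :
    Bimodule (BeurlingAlgebra ω) (lp (fun _ : WithOne S × WithOne S => ℂ) ∞) :=
  liftBimodule leftTranslation twistedRight 1 2 (norm_leftTranslation_le hω)
    (norm_twistedRight_le hω)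
    (fun s t F => by
      ext p
      simp only [leftTranslation_apply, WithOne.coe_mul, mul_assoc])
    (fun s t F => by
      ext p
      simp only [twistedRight_apply, WithOne.coe_mul, mul_assoc]
      ring)
    (fun s t F => by
      ext p
      simp only [twistedRight_apply, leftTranslation_apply, mul_assoc])

/-- The derivation into the dual of the dimension-shifting bimodule: `s ↦ (F ↦ F (s, 1))`. -/
noncomputable def shiftDerivation (hω : ∀ s, 1 ≤ ω s) :
    BeurlingAlgebra ω →L[ℂ] (lp (fun _ : WithOne S × WithOne S => ℂ) ∞ →L[ℂ] ℂ) :=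
  lift (fun s => lp.evalCLM ℂ (fun _ => ℂ) ∞ ((s : WithOne S), (1 : WithOne S))) 1 fun s => by
    rw [one_mul]
    refine (ContinuousLinearMap.opNorm_le_bound _ zero_le_one fun F => ?_).trans (hω s)
    rw [one_mul]
    exact lp.norm_apply_le_norm ENNReal.top_ne_zero F _

theorem shiftDerivation_delta (hω : ∀ s, 1 ≤ ω s) (s : S)
    (F : lp (fun _ : WithOne S × WithOne S => ℂ) ∞) :
    shiftDerivation hω (delta ω s) F = F (s, 1) := by
  rw [shiftDerivation, lift_delta]
  rfl

/-- The twist makes this a telescoping identity: `F (st, 1) = F (s, t) + (F (st, 1) - F (s, t))`. -/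
theorem isDerivation_shiftDerivation (hω : ∀ s, 1 ≤ ω s) :
    (shiftBimodule hω).dual.IsDerivation (shiftDerivation hω) := by
  refine isDerivation_of_delta fun s t => ?_
  ext F
  rw [delta_mul_delta, shiftDerivation_delta, _root_.add_apply,
    Bimodule.dual_right_apply, Bimodule.dual_left_apply, shiftBimodule, liftBimodule_left_delta,
    liftBimodule_right_delta, shiftDerivation_delta, shiftDerivation_delta,
    leftTranslation_apply, twistedRight_apply]
  simp

theorem exists_isVirtualDiagonal (hω : ∀ s, 1 ≤ ω s) (hA : IsAmenable (BeurlingAlgebra ω)) :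
    ∃ m : lp (fun _ : WithOne S × WithOne S => ℂ) ∞ →L[ℂ] ℂ, IsVirtualDiagonal m := by
  obtain ⟨n, hn⟩ := hA _ (shiftBimodule hω) _ (isDerivation_shiftDerivation hω)
  have hn' : ∀ (u : S) F, F ((u : WithOne S), (1 : WithOne S))
      = n (twistedRight u F) - n (leftTranslation u F) := fun u F => by
    have h := DFunLike.congr_fun (hn (delta ω u)) F
    rw [shiftDerivation_delta, _root_.sub_apply, Bimodule.dual_right_apply,
      Bimodule.dual_left_apply, shiftBimodule, liftBimodule_left_delta,
      liftBimodule_right_delta] at h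
    exact h
  let ev : lp (fun _ : WithOne S × WithOne S => ℂ) ∞ →L[ℂ] ℂ := lp.evalCLM ℂ _ ∞ (1, 1)
  let P : lp (fun _ : WithOne S × WithOne S => ℂ) ∞ →L[ℂ]
      lp (fun _ : WithOne S × WithOne S => ℂ) ∞ :=
    boundedComp (fun p : WithOne S × WithOne S => ((1 : WithOne S), p.1 * p.2))
  -- `P` fixes every function of the product `p.1 * p.2`, so on these `m` is evaluation at `(1, 1)`,
  -- which gives unitality. Balance is the inner identity `hn'` applied to `F - P F`, whose value at
  -- `(u, 1)` is `F (u, 1) - F (1, u)`.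
  let m : lp (fun _ : WithOne S × WithOne S => ℂ) ∞ →L[ℂ] ℂ :=
    ev - n.comp (ContinuousLinearMap.id ℂ _ - P)
  have hP : ∀ F, m F = F (1, 1) - n (F - P F) := fun _ => rfl
  refine ⟨m, fun u F => ?_, fun f => ?_⟩
  · induction u using WithOne.recOneCoe with
    | one => simp
    | coe u =>
      have h := hn' u (F - P F)
      rw [← map_sub] at h
      rw [hP, hP, ← sub_eq_zero, sub_sub_sub_comm, ← map_sub, sub_eq_zero]
      convert h using 1
      · simp [P, boundedComp_apply]
      · congr 1
        ext p
        change (F (u * p.1, p.2) - F (u * 1, p.1 * p.2)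
            - (F (p.1, p.2 * u) - F (1, p.1 * p.2 * u)) : ℂ)
          = F (u * p.1, p.2) - F (1, u * p.1 * p.2) - (F (u, p.1 * p.2) - F (1, u * (p.1 * p.2)))
            - (F (p.1, p.2 * u) - F (1, p.1 * (p.2 * u)))
        rw [mul_one, mul_assoc, mul_assoc]
        ring
  · rw [hP]
    have : boundedComp (fun p : WithOne S × WithOne S => p.1 * p.2) f
        - P (boundedComp (fun p => p.1 * p.2) f) = 0 := by
      ext p
      simp [P, boundedComp_apply]
    rw [this, map_zero, sub_zero]
    simp [boundedComp_apply]

end BeurlingAlgebra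

/-! ### Bands and finitely additive measures -/

/-- In a band monoid, an element below `c` in the two-sided ideal order absorbs `c`. -/
theorem band_absorb {M : Type*} [Monoid M] (hM : ∀ x : M, x * x = x) {b c p q : M}
    (h : b = p * c * q) : b * c * b = b := by
  have h1 : p * c * b = b := by rw [h, ← mul_assoc, hM]
  have h2 : b * c * q = b := by
    have h3 : c * q * (c * q) = c * q := hM _
    calc b * c * q = p * (c * q * (c * q)) := by rw [h]; simp only [mul_assoc]
      _ = b := by rw [h3, h, mul_assoc]
  have h3 : b * (c * (q * p) * c) * b = b := by
    calc b * (c * (q * p) * c) * b = (b * c * q) * (p * c * b) := by simp only [mul_assoc]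
      _ = b := by rw [h1, h2, hM]
  have h4 : c * (c * (q * p) * c) = c * (q * p) * c := by simp only [← mul_assoc, hM]
  have h5 : b * c * ((c * (q * p) * c) * b) = b := by
    calc b * c * ((c * (q * p) * c) * b) = b * (c * (c * (q * p) * c)) * b := by
          simp only [mul_assoc]
      _ = b := by rw [h4, h3]
  -- By `h5`, `b` is a left multiple of the form `(b * c) * z`, so the idempotent `b * c` fixes it
  -- from the left.
  calc b * c * b = b * c * (b * c * ((c * (q * p) * c) * b)) := by rw [h5]
    _ = (b * c * (b * c)) * ((c * (q * p) * c) * b) := by simp only [mul_assoc]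
    _ = b := by rw [hM, h5]

open Classical in
/-- The indicator function of a set, as a bounded function. -/
noncomputable def boundedIndicator {X : Type*} (U : Set X) : lp (fun _ : X => ℂ) ∞ :=
  ⟨U.indicator 1, memℓp_infty ⟨1, by
    rintro _ ⟨x, rfl⟩
    by_cases h : x ∈ U <;> simp [h]⟩⟩

theorem boundedIndicator_apply {X : Type*} (U : Set X) (x : X) :
    boundedIndicator U x = U.indicator 1 x := rfl

namespace IsVirtualDiagonal

variable {M : Type*} [Monoid M] {m : lp (fun _ : M × M => ℂ) ∞ →L[ℂ] ℂ}

theorem balanced_set (hm : IsVirtualDiagonal m) (u : M) (U : Set (M × M)) :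
    m (boundedIndicator {p | (u * p.1, p.2) ∈ U})
      = m (boundedIndicator {p | (p.1, p.2 * u) ∈ U}) :=
  hm.balanced u (boundedIndicator U)

theorem unital_set (hm : IsVirtualDiagonal m) (U : Set M) :
    m (boundedIndicator {p | p.1 * p.2 ∈ U}) = U.indicator 1 1 :=
  hm.unital (boundedIndicator U)

theorem op (hm : IsVirtualDiagonal m) :
    IsVirtualDiagonal (M := Mᵐᵒᵖ) (m.comp (boundedComp fun p => (MulOpposite.op p.2, MulOpposite.op p.1))) where
  balanced u F := (hm.balanced u.unop (boundedComp (fun p : M × M => (MulOpposite.op p.2, MulOpposite.op p.1)) F)).symm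
  unital f := hm.unital (boundedComp MulOpposite.op f)

/-- A virtual diagonal rules out nontrivial right zero subbands. -/
theorem eq_of_right_zero (hm : IsVirtualDiagonal m) (hM : ∀ x : M, x * x = x) {x y : M}
    (hxy : x * y = y) (hyx : y * x = x) : x = y := by
  by_contra hne
  -- Moving `x` or `y` to the second variable makes the condition on `p.2` automatic and leaves a
  -- condition on the product, so unitality gives measure 1 for `x` and 0 for `y`. On the first
  -- variable, the condition on `p.2` makes `x` and `y` interchangeable (`h3`), so the two measures
  -- agree: a contradiction.
  let U : Set (M × M) := {p | p.1 * p.2 = x ∧ p.2 * x * p.2 = p.2}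
  have h1 : {p : M × M | (p.1, p.2 * x) ∈ U} = {p | p.1 * p.2 ∈ {v | v * x = x}} := by
    ext ⟨s, t⟩
    have : t * x * x * (t * x) = t * x := by rw [mul_assoc t x x, hM, hM]
    exact (and_iff_left this).trans (by rw [← mul_assoc]; rfl)
  have h2 : {p : M × M | (p.1, p.2 * y) ∈ U} = {p | p.1 * p.2 ∈ {v | v * y = x}} := by
    ext ⟨s, t⟩
    have : t * y * x * (t * y) = t * y := by
      rw [mul_assoc t y x, hyx, ← hxy, ← mul_assoc t x y, ← mul_assoc, hM]
    exact (and_iff_left this).trans (by rw [← mul_assoc]; rfl)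
  have h3 : {p : M × M | (x * p.1, p.2) ∈ U} = {p | (y * p.1, p.2) ∈ U} := by
    ext ⟨s, t⟩
    simp only [U, Set.mem_ofPred_eq, and_congr_left_iff]
    intro ht
    have hw : s * t * x * (s * t) = s * t :=
      band_absorb hM (p := s * t) (q := t) (by rw [mul_assoc s t x, mul_assoc s, ht])
    rw [mul_assoc, mul_assoc]
    generalize s * t = w at hw
    constructor <;> intro h
    · have hwx : w = w * x := by
        calc w = w * x * w := hw.symm
          _ = w * (x * w) := mul_assoc _ _ _
          _ = w * x := by rw [h]
      have hwy : w * y * w = w := band_absorb hM (p := w) (q := x) (by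
        rw [mul_assoc, hyx, ← hwx])
      calc y * w = x * y * w := by rw [hxy]
        _ = x * w * y * w := by rw [h]
        _ = x * (w * y * w) := by simp only [mul_assoc]
        _ = x := by rw [hwy, h]
    · calc x * w = y * w * w := by rw [h]
        _ = x := by rw [mul_assoc, hM, h]
  have e1 := hm.balanced_set x U
  have e2 := hm.balanced_set y U
  rw [h1, hm.unital_set] at e1
  rw [h2, hm.unital_set, ← h3, e1] at e2
  simp [Ne.symm hne] at e2

theorem eq_of_left_zero (hm : IsVirtualDiagonal m) (hM : ∀ x : M, x * x = x) {x y : M}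
    (hxy : x * y = x) (hyx : y * x = y) : x = y :=
  MulOpposite.op_injective (hm.op.eq_of_right_zero (fun _ => MulOpposite.unop_injective (hM _))
    (congrArg MulOpposite.op hyx) (congrArg MulOpposite.op hxy))

/-- Elements generating the same ideal span a rectangular band. There `x` and `x * y` form a right
zero pair, and `y` and `x * y` a left zero pair, so all three coincide. This applies to `s * t` and
`t * s`. -/
theorem mul_comm_of_band (hm : IsVirtualDiagonal m) (hM : ∀ x : M, x * x = x) (s t : M) :
    s * t = t * s := by
  have key : ∀ x y : M, x * y * x = x → y * x * y = y → x = y := by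
    intro x y hx hy
    have h1 : x = x * y := hm.eq_of_right_zero hM (by rw [← mul_assoc, hM]) hx
    have h2 : y = x * y := hm.eq_of_left_zero hM (by rw [← mul_assoc, hy]) (by
      rw [mul_assoc, hM])
    rw [h1, ← h2]
  have h : ∀ s t : M, s * t * (t * s) * (s * t) = s * t := fun s t => by
    calc s * t * (t * s) * (s * t) = s * (t * t) * (s * s) * t := by simp only [mul_assoc]
      _ = (s * t) * (s * t) := by rw [hM, hM]; simp only [mul_assoc]
      _ = s * t := hM _
  exact key _ _ (h s t) (h t s)

end IsVirtualDiagonal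

/-! ### Semilattices: characters and the size of a virtual diagonal -/

section

variable {M : Type*} [CommMonoid M]

theorem norm_char_le_one (hM : ∀ x : M, x * x = x) (χ : M →* ℂ) (s : M) : ‖χ s‖ ≤ 1 := by
  have h : χ s * χ s = χ s := by rw [← map_mul, hM]
  rcases IsIdempotentElem.iff_eq_zero_or_one.1 h with h | h <;> simp [h]

/-- The bounded function `(s, t) ↦ χ(s) χ'(t)`. -/
noncomputable def charTensor (hM : ∀ x : M, x * x = x) (χ χ' : M →* ℂ) :
    lp (fun _ : M × M => ℂ) ∞ :=
  ⟨fun p => χ p.1 * χ' p.2, memℓp_infty ⟨1, by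
    rintro _ ⟨p, rfl⟩
    refine (norm_mul _ _).trans_le ?_
    exact mul_le_one₀ (norm_char_le_one hM χ _) (norm_nonneg _) (norm_char_le_one hM χ' _)⟩⟩

theorem charTensor_apply (hM : ∀ x : M, x * x = x) (χ χ' : M →* ℂ) (p : M × M) :
    charTensor hM χ χ' p = χ p.1 * χ' p.2 := rfl

-- Balance gives `(χ u - χ' u) * m (χ ⊗ χ') = 0` for all `u`. On the diagonal, `χ ⊗ χ` is `χ` of the
-- product, so unitality gives `χ 1 = 1`.
open Classical in
theorem IsVirtualDiagonal.apply_charTensor {m : lp (fun _ : M × M => ℂ) ∞ →L[ℂ] ℂ}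
    (hm : IsVirtualDiagonal m) (hM : ∀ x : M, x * x = x) (χ χ' : M →* ℂ) :
    m (charTensor hM χ χ') = if χ = χ' then 1 else 0 := by
  split_ifs with h
  · subst h
    let f : lp (fun _ : M => ℂ) ∞ := ⟨fun s => χ s, memℓp_infty ⟨1, by
      rintro _ ⟨p, rfl⟩
      exact norm_char_le_one hM χ p⟩⟩
    have hf : charTensor hM χ χ = boundedComp (fun p => p.1 * p.2) f := by
      ext p
      exact (map_mul χ p.1 p.2).symm
    rw [hf, hm.unital]
    exact map_one χ
  · obtain ⟨u, hu⟩ : ∃ u, χ u ≠ χ' u := by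
      by_contra! hall
      exact h (MonoidHom.ext hall)
    have h1 : boundedComp (fun p : M × M => (u * p.1, p.2)) (charTensor hM χ χ')
        = χ u • charTensor hM χ χ' := by
      ext p
      simp [boundedComp_apply, charTensor_apply, mul_assoc]
    have h2 : boundedComp (fun p : M × M => (p.1, p.2 * u)) (charTensor hM χ χ')
        = χ' u • charTensor hM χ χ' := by
      ext p
      simp [boundedComp_apply, charTensor_apply]
      ring
    have h3 := hm.balanced u (charTensor hM χ χ')
    rw [h1, h2, map_smul, map_smul, ← sub_eq_zero, ← sub_smul, smul_eq_mul] at h3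
    exact (mul_eq_zero.1 h3).resolve_left (sub_ne_zero.2 hu)

/-- The ring of integer combinations of characters. -/
def charRing (M : Type*) [CommMonoid M] : Subalgebra ℤ (M → ℂ) :=
  Algebra.adjoin ℤ (MonoidHom.mrange (MonoidHom.coeFn M ℂ) : Set (M → ℂ))

theorem char_mem_charRing (χ : M →* ℂ) : (χ : M → ℂ) ∈ charRing M :=
  Algebra.subset_adjoin ⟨χ, rfl⟩

/-- A product of characters is a character, so the ring they generate is their integer span. -/
theorem exists_finsupp_of_mem_charRing {f : M → ℂ} (hf : f ∈ charRing M) :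
    ∃ c : (M →* ℂ) →₀ ℤ, ∀ s, f s = ∑ χ ∈ c.support, (c χ : ℂ) * χ s := by
  rw [charRing, ← Subalgebra.mem_toSubmodule, Algebra.adjoin_eq_span, Submonoid.closure_eq,
    MonoidHom.coe_mrange, Finsupp.mem_span_range_iff_exists_finsupp] at hf
  obtain ⟨c, rfl⟩ := hf
  refine ⟨c, fun s => ?_⟩
  simp [Finsupp.sum, Finset.sum_apply]

/-- If the indicator is `∑ c_χ χ`, orthonormality makes the value `∑ c_χ²`. Integrality is the
point: a nonzero sum of integer squares is at least 1. -/
theorem IsVirtualDiagonal.one_le_re_apply {m : lp (fun _ : M × M => ℂ) ∞ →L[ℂ] ℂ}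
    (hm : IsVirtualDiagonal m) (hM : ∀ x : M, x * x = x) {U : Set M} (hU : U.Nonempty)
    (hUr : U.indicator 1 ∈ charRing M) : 1 ≤ (m (boundedIndicator (U ×ˢ U))).re := by
  classical
  obtain ⟨c, hc⟩ := exists_finsupp_of_mem_charRing hUr
  have h1 : boundedIndicator (U ×ˢ U)
      = ∑ χ ∈ c.support, ∑ χ' ∈ c.support, ((c χ : ℂ) * c χ') • charTensor hM χ χ' := by
    ext p
    have h2 : boundedIndicator (U ×ˢ U) p
        = (U.indicator 1 p.1 : ℂ) * (U.indicator 1 p.2 : ℂ) := by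
      rw [boundedIndicator_apply]
      by_cases h1 : p.1 ∈ U <;> by_cases h2 : p.2 ∈ U <;> simp [Set.indicator, h1, h2]
    rw [h2, hc, hc, Finset.sum_mul_sum, lp.coeFn_sum, Finset.sum_apply]
    refine Finset.sum_congr rfl fun χ _ => ?_
    rw [lp.coeFn_sum, Finset.sum_apply]
    refine Finset.sum_congr rfl fun χ' _ => ?_
    rw [lp.coeFn_smul, Pi.smul_apply, charTensor_apply, smul_eq_mul]
    ring
  have h2 : m (boundedIndicator (U ×ˢ U)) = ((∑ χ ∈ c.support, c χ * c χ : ℤ) : ℂ) := by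
    rw [h1, map_sum]
    push_cast
    refine Finset.sum_congr rfl fun χ hχ => ?_
    rw [map_sum, Finset.sum_eq_single_of_mem χ hχ]
    · rw [map_smul, hm.apply_charTensor, if_pos rfl, smul_eq_mul, mul_one]
    · intro χ' _ hne
      rw [map_smul, hm.apply_charTensor, if_neg hne.symm, smul_zero]
  have h3 : 0 < ∑ χ ∈ c.support, c χ * c χ := by
    refine Finset.sum_pos (fun χ hχ => mul_self_pos.2 (Finsupp.mem_support_iff.1 hχ)) ?_
    obtain ⟨s, hs⟩ := hU
    by_contra hempty
    have := hc s
    rw [Finset.not_nonempty_iff_eq_empty.1 hempty] at this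
    simp [hs] at this
  rw [h2, Complex.intCast_re]
  exact_mod_cast h3

open Classical in
/-- The character of the principal filter of `z` in a semilattice. -/
noncomputable def filterChar (hM : ∀ x : M, x * x = x) (z : M) : M →* ℂ where
  toFun s := if z * s = z then 1 else 0
  map_one' := by simp
  map_mul' s t := by
    have h : z * (s * t) = z ↔ z * s = z ∧ z * t = z := by
      constructor
      · intro h
        constructor
        · rw [← h, mul_right_comm, ← mul_assoc, mul_assoc z s s, hM, mul_assoc]
        · rw [← h, mul_assoc, mul_assoc, hM]
      · rintro ⟨hs, ht⟩
        rw [← mul_assoc, hs, ht]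
    by_cases hs : z * s = z <;> by_cases ht : z * t = z <;> simp [h, hs, ht]

open Classical in
theorem filterChar_apply (hM : ∀ x : M, x * x = x) (z s : M) :
    filterChar hM z s = if z * s = z then 1 else 0 := rfl

/-- The atom of `y` in the Boolean algebra generated by the principal filters of `T`. -/
def filterAtom (T : Finset M) (y : M) : Set M := {s | ∀ z ∈ T, z * s = z ↔ z * y = z}

/-- The indicator is the product over `z ∈ T` of the filter character of `z` or its complement. -/
theorem indicator_filterAtom_mem_charRing (hM : ∀ x : M, x * x = x) (T : Finset M) (y : M) :
    (filterAtom T y).indicator 1 ∈ charRing M := by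
  classical
  have h : (filterAtom T y).indicator (1 : M → ℂ)
      = ∏ z ∈ T, if z * y = z then (filterChar hM z : M → ℂ) else 1 - filterChar hM z := by
    ext s
    rw [Finset.prod_apply]
    by_cases hs : s ∈ filterAtom T y
    · rw [Set.indicator_of_mem hs, Pi.one_apply, Finset.prod_eq_one]
      intro z hz
      have := hs z hz
      by_cases hy : z * y = z <;> simp [hy, filterChar_apply, this]
    · rw [Set.indicator_of_notMem hs]
      simp only [filterAtom, Set.mem_ofPred_eq, not_forall] at hs
      obtain ⟨z, hz, hzs⟩ := hs
      symm
      refine Finset.prod_eq_zero hz ?_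
      by_cases hy : z * y = z <;> simp_all [filterChar_apply]
  rw [h]
  refine prod_mem fun z _ => ?_
  split_ifs
  · exact char_mem_charRing _
  · exact sub_mem (one_mem _) (char_mem_charRing _)

/-- The atoms of distinct elements of `T` are disjoint, so the indicators of their squares sum to a
function of norm at most 1, while each square contributes at least 1 to the real part of `m`. -/
theorem IsVirtualDiagonal.card_le_norm {m : lp (fun _ : M × M => ℂ) ∞ →L[ℂ] ℂ}
    (hm : IsVirtualDiagonal m) (hM : ∀ x : M, x * x = x) (T : Finset M) : (T.card : ℝ) ≤ ‖m‖ := by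
  classical
  let V : M → Set (M × M) := fun y => filterAtom T y ×ˢ filterAtom T y
  have hdisj : ∀ y ∈ T, ∀ y' ∈ T, ∀ s, s ∈ filterAtom T y → s ∈ filterAtom T y' → y = y' := by
    intro y hy y' hy' s h h'
    have h1 : y * y' = y := (h' y hy).1 ((h y hy).2 (hM y))
    have h2 : y' * y = y' := (h y' hy').1 ((h' y' hy').2 (hM y'))
    rw [← h1, mul_comm, h2]
  let F : lp (fun _ : M × M => ℂ) ∞ := ∑ y ∈ T, boundedIndicator (V y)
  have hF : ‖F‖ ≤ 1 := by
    refine lp.norm_le_of_forall_le zero_le_one fun p => ?_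
    have hFp : F p = ∑ y ∈ T, (V y).indicator 1 p := by
      rw [lp.coeFn_sum, Finset.sum_apply]
      rfl
    rw [hFp]
    by_cases hp : ∃ y ∈ T, p ∈ V y
    · obtain ⟨y, hy, hpy⟩ := hp
      rw [Finset.sum_eq_single_of_mem y hy, Set.indicator_of_mem hpy]
      · simp
      · intro y' hy' hne
        exact Set.indicator_of_notMem (fun h => hne (hdisj _ hy' _ hy _ h.1 hpy.1)) _
    · push Not at hp
      rw [Finset.sum_eq_zero fun y hy => Set.indicator_of_notMem (hp y hy) _]
      simp
  have h1 : (T.card : ℝ) ≤ (m F).re := by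
    rw [map_sum, Complex.re_sum, ← nsmul_one]
    exact Finset.card_nsmul_le_sum _ _ _ fun y _ =>
      hm.one_le_re_apply hM ⟨y, fun _ _ => Iff.rfl⟩ (indicator_filterAtom_mem_charRing hM T y)
  calc (T.card : ℝ) ≤ (m F).re := h1
    _ ≤ ‖m F‖ := Complex.re_le_norm _
    _ ≤ ‖m‖ * 1 := m.le_of_opNorm_le_of_le le_rfl hF
    _ = ‖m‖ := mul_one _

theorem IsVirtualDiagonal.finite {m : lp (fun _ : M × M => ℂ) ∞ →L[ℂ] ℂ}
    (hm : IsVirtualDiagonal m) (hM : ∀ x : M, x * x = x) : Finite M := by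
  by_contra h
  rw [not_finite_iff_infinite] at h
  obtain ⟨N, hN⟩ := exists_nat_gt ‖m‖
  obtain ⟨T, hT⟩ := Infinite.exists_subset_card_eq M N
  have := hm.card_le_norm hM T
  rw [hT] at this
  exact absurd hN (not_lt.2 this)

end

/-! ### The main theorem -/

theorem WithOne.mul_self_of_band {S : Type*} [Semigroup S] (hS : IsBandSemigroup S)
    (x : WithOne S) : x * x = x := by
  induction x using WithOne.recOneCoe with
  | one => exact mul_one 1
  | coe s => rw [← WithOne.coe_mul, (hS s).eq]

theorem BeurlingAlgebra.finite_semilattice_of_isAmenable {S : Type*} [Semigroup S]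
    (hS : IsBandSemigroup S) {ω : SemigroupWeight S} (hA : IsAmenable (BeurlingAlgebra ω)) :
    Finite S ∧ IsSemilatticeSemigroup S := by
  obtain ⟨m, hm⟩ := exists_isVirtualDiagonal (fun s => ω.one_le (hS s)) hA
  have hM := WithOne.mul_self_of_band hS
  have hcomm := hm.mul_comm_of_band hM
  -- The new structure extends the existing monoid, so the properties of `m` carry over unchanged.
  let _ : CommMonoid (WithOne S) := { (inferInstance : Monoid (WithOne S)) with mul_comm := hcomm }
  have hfin : Finite (WithOne S) := IsVirtualDiagonal.finite ⟨hm.balanced, hm.unital⟩ hM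
  refine ⟨Finite.of_injective _ WithOne.coe_injective, hS, fun s t => ?_⟩
  have := hcomm s t
  rwa [← WithOne.coe_mul, ← WithOne.coe_mul, WithOne.coe_inj] at this

theorem principalIdeal_mul_comm {S : Type*} [Semigroup S] (hS : IsBandSemigroup S) (s t : S) :
    principalIdeal (s * t) = principalIdeal (t * s) := by
  have h : ∀ s t : S, principalIdeal (s * t) ⊆ principalIdeal (t * s) := by
    rintro s t _ ⟨a, b, rfl⟩
    -- Idempotence gives `s * t = s * (t * s) * t`.
    refine ⟨a * s, t * b, ?_⟩
    rw [← WithOne.mul_self_of_band hS ((s * t : S) : WithOne S)]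
    simp only [WithOne.coe_mul, mul_assoc]
  exact (h s t).antisymm (h t s)

theorem eq_of_principalIdeal_eq {S : Type*} [Semigroup S] (hS : IsSemilatticeSemigroup S) {s t : S}
    (h : principalIdeal s = principalIdeal t) : s = t := by
  have hcomm : ∀ x y : WithOne S, x * y = y * x := fun x y => by
    induction x using WithOne.recOneCoe with
    | one => rw [one_mul, mul_one]
    | coe x =>
      induction y using WithOne.recOneCoe with
      | one => rw [one_mul, mul_one]
      | coe y => rw [← WithOne.coe_mul, hS.2, WithOne.coe_mul]
  have hle : ∀ {s t : S}, principalIdeal s = principalIdeal t → s * t = s := fun {s t} h => by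
    have hs : (s : WithOne S) ∈ principalIdeal t := h ▸ ⟨1, 1, by rw [one_mul, mul_one]⟩
    obtain ⟨a, b, hab⟩ := hs
    rw [← WithOne.coe_inj, WithOne.coe_mul, hab, mul_assoc, hcomm b t, ← mul_assoc, mul_assoc a,
      WithOne.mul_self_of_band hS.1]
  rw [← hle h, hS.2, hle h.symm]

theorem theorem2p6 {S : Type*} [Semigroup S] (hS : IsBandSemigroup S) (ω : SemigroupWeight S) :
    List.TFAE [
      BanachAmenability.IsAmenable (BeurlingAlgebra ω),
      Finite S ∧ ∀ c ∈ (tauSetoid S).classes, ∃ s : S, c = {s},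
      BanachAmenability.IsAmenable (BeurlingAlgebra (SemigroupWeight.trivial S)),
      Finite S ∧ IsSemilatticeSemigroup S] := by
  tfae_have 1 → 4 := BeurlingAlgebra.finite_semilattice_of_isAmenable hS
  tfae_have 3 → 4 := BeurlingAlgebra.finite_semilattice_of_isAmenable hS
  tfae_have 4 → 1 := fun ⟨_, h⟩ => BeurlingAlgebra.isAmenable_of_finite_semilattice h
  tfae_have 4 → 3 := fun ⟨_, h⟩ => BeurlingAlgebra.isAmenable_of_finite_semilattice h
  tfae_have 2 → 4 := by
    rintro ⟨hfin, h⟩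
    refine ⟨hfin, hS, fun s t => ?_⟩
    obtain ⟨x, hx⟩ := h _ ⟨t * s, rfl⟩
    have h1 : s * t ∈ ({x} : Set S) := hx ▸ principalIdeal_mul_comm hS s t
    have h2 : t * s ∈ ({x} : Set S) := hx ▸ (rfl : principalIdeal (t * s) = _)
    exact h1.trans h2.symm
  tfae_have 4 → 2 := by
    rintro ⟨hfin, h⟩
    refine ⟨hfin, ?_⟩
    rintro _ ⟨y, rfl⟩
    refine ⟨y, Set.ext fun x => ⟨fun hx => eq_of_principalIdeal_eq h hx, ?_⟩⟩
    rintro rfl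
    exact (tauSetoid S).refl _
  tfae_finish
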